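/- Identify a set of natural numbers with its characteristic function, and for $X,Y\subseteq\mathbb N$ write $X\leq_{\mathrm{lex}}Y$ if $X=Y$ or the least element of the symmetric difference $X\mathbin{\triangle}Y$ belongs to $Y$. A set $A\subseteq\mathbb N$ is \emph{left-r.e.} if there is a uniformly recursive sequence of sets $A_0\leq_{\mathrm{lex}}A_1\leq_{\mathrm{lex}}\cdots$ converging pointwise to $A$. A \emph{left-r.e. numbering} is a map $e\mapsto\alpha_e\subseteq\mathbb N$ for which there are sets $\alpha_{e,s}$ such that $(e,s,n)\mapsto\alpha_{e,s}(n)\in\{0,1\}$ is recursive, $\alpha_{e,s}\leq_{\mathrm{lex}}\alpha_{e,s+1}$ for all $e,s$, and $\alpha_e=\lim_{s\to\infty}\alpha_{e,s}$ pointwise for all $e$. It is \emph{universal} if every left-r.e. set equals $\alpha_e$ for some $e$. A class $\mathcal C$ of sets of natural numbers \emph{can be made into itself} if there is a universal left-r.e. numbering $\beta$ with $\{e:\beta_e\in\mathcal C\}\in\mathcal C$. \textbf{Theorem.} Let $A\subseteq\mathbb N$ be a left-r.e. set. Then the class $\{A\}$ can be made into itself if and only if $A\neq\emptyset$ and there exists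 an infinite r.e. set $B\subseteq\mathbb N$ such that $A\cap B=\emptyset$. -/

import Mathlib

open Filter

namespace LeftRE

/-- The lexicographic order on sets of natural numbers: `A = B`, or the least element of the
symmetric difference of `A` and `B` belongs to `B`. -/
def LexLE (A B : Set ℕ) : Prop :=
  A = B ∨ ∃ x, IsLeast (symmDiff A B) x ∧ x ∈ B

/-- The sequence of sets `S` converges pointwise to `A`: for every `n`, the truth value of
`n ∈ S s` is eventually that of `n ∈ A`. -/
def ConvergesTo (S : ℕ → Set ℕ) (A : Set ℕ) : Prop :=
  ∀ n, ∀ᶠ s in atTop, (n ∈ S s ↔ n ∈ A)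

/-- `A` is left-r.e.: it is the limit of a uniformly recursive sequence of sets that is
nondecreasing in the lexicographic order. -/
def IsLeftRE (A : Set ℕ) : Prop :=
  ∃ S : ℕ → Set ℕ,
    ComputablePred (fun p : ℕ × ℕ => p.2 ∈ S p.1) ∧
    (∀ s, LexLE (S s) (S (s + 1))) ∧
    ConvergesTo S A

/-- `α` is a left-r.e. numbering: there are sets `T e s`, with `n ∈ T e s` decidable
uniformly in `e, s, n`, such that each sequence `T e 0, T e 1, …` is nondecreasing in the
lexicographic order and has limit `α e`. -/
def IsLeftRENumbering (α : ℕ → Set ℕ) : Prop :=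
  ∃ T : ℕ → ℕ → Set ℕ,
    ComputablePred (fun p : ℕ × ℕ × ℕ => p.2.2 ∈ T p.1 p.2.1) ∧
    (∀ e s, LexLE (T e s) (T e (s + 1))) ∧
    ∀ e, ConvergesTo (T e) (α e)

/-- A left-r.e. numbering is universal if its range includes all left-r.e. sets. -/
def IsUniversalLeftRENumbering (α : ℕ → Set ℕ) : Prop :=
  IsLeftRENumbering α ∧ ∀ A, IsLeftRE A → A ∈ Set.range α

/-- The index set of the class `C` in the numbering `α`. -/
def indexSet (α : ℕ → Set ℕ) (C : Set (Set ℕ)) : Set ℕ :=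
  {e | α e ∈ C}

/-- The class `C` can be made into itself: in some universal left-r.e. numbering, the index
set of `C` is a member of `C`. -/
def CanBeMadeIntoItself (C : Set (Set ℕ)) : Prop :=
  ∃ β : ℕ → Set ℕ, IsUniversalLeftRENumbering β ∧ indexSet β C ∈ C

end LeftRE

/-! Necessity: let `β` be universal with `{e | β e = A} = A`. Then `A` is nonempty because `A` has
an index, and `A` is not `ℕ` because `∅` has one. Fix `m ∉ A`. The indices `e` for which `β e`
exceeds `A` on the first `m + 1` digits form an r.e. set, since left approximations only increase.
It is infinite and contains no index of `A` (`exists_infinite_re_disjoint_indexSet`).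

Sufficiency: pick an infinite recursive `R ⊆ B`, the range of an increasing recursive `f`. Off `R`,
index `e` receives a set equal to `A` exactly when `e ∈ A` (`exists_selfIndexed`). On `R`, which
misses `A`, the indices must list all left-r.e. sets except `A`. Take a numbering of all left-r.e.
sets (`exists_lim_universalApprox`) and pair each entry with a guess, a rational cut separating it
from `A`. A correct guess keeps the set; a wrong one turns it into `∅` or `ℕ` (`avoid_ne`,
`exists_avoid_eq`). These two are harmless, as `A` is neither. -/

namespace LeftRE

/-! ### Lexicographic order as comparison of binary prefixes -/

/-- The number whose binary digits, most significant first, are `x 0, …, x (n - 1)`. -/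
def prefixVal (x : ℕ → Bool) : ℕ → ℕ
  | 0 => 0
  | n + 1 => 2 * prefixVal x n + (x n).toNat

theorem prefixVal_lt (x : ℕ → Bool) (n : ℕ) : prefixVal x n < 2 ^ n := by
  induction n with
  | zero => simp [prefixVal]
  | succ n ih =>
    have := Bool.toNat_le (x n)
    rw [prefixVal, pow_succ]
    omega

theorem prefixVal_congr {x y : ℕ → Bool} {n : ℕ} (h : ∀ i < n, x i = y i) :
    prefixVal x n = prefixVal y n := by
  induction n with
  | zero => rfl
  | succ n ih =>
    rw [prefixVal, prefixVal, ih fun i hi => h i (hi.trans n.lt_succ_self), h n n.lt_succ_self]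

theorem eq_of_prefixVal_eq {x y : ℕ → Bool} {n : ℕ} (h : prefixVal x n = prefixVal y n) :
    ∀ i < n, x i = y i := by
  induction n with
  | zero => simp
  | succ n ih =>
    rw [prefixVal, prefixVal] at h
    have hn : x n = y n := by
      cases hx : x n <;> cases hy : y n <;> simp [hx, hy] at h ⊢ <;> omega
    rw [hn] at h
    intro i hi
    rcases Nat.lt_succ_iff_lt_or_eq.1 hi with hi | rfl
    · exact ih (by omega) i hi
    · exact hn

theorem prefixVal_lt_of_lt {x y : ℕ → Bool} {m n : ℕ} (hmn : m ≤ n)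
    (h : prefixVal x m < prefixVal y m) : prefixVal x n < prefixVal y n := by
  induction n, hmn using Nat.le_induction with
  | base => exact h
  | succ n _ ih =>
    have := Bool.toNat_le (x n)
    rw [prefixVal, prefixVal]
    omega

theorem prefixVal_false (n : ℕ) : prefixVal (fun _ => false) n = 0 := by
  induction n with
  | zero => rfl
  | succ n ih => simp [prefixVal, ih]

theorem prefixVal_le_true (x : ℕ → Bool) (n : ℕ) :
    prefixVal x n ≤ prefixVal (fun _ => true) n := by
  induction n with
  | zero => rfl
  | succ n ih =>
    have := Bool.toNat_le (x n)
    simp only [prefixVal, Bool.toNat_true]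
    omega

theorem lexLE_iff {x y : ℕ → Bool} :
    LexLE {i | x i = true} {i | y i = true} ↔ ∀ n, prefixVal x n ≤ prefixVal y n := by
  constructor
  · rintro (h | ⟨k, ⟨hk, hmin⟩, hky⟩) n
    · refine (prefixVal_congr fun i _ => ?_).le
      exact Bool.eq_iff_iff.2 (Set.ext_iff.1 h i)
    · have hlow : ∀ i < k, x i = y i := by
        intro i hi
        by_contra hne
        refine absurd (hmin ?_) (not_le.2 hi)
        cases hx : x i <;> cases hy : y i <;> simp_all [Set.mem_symmDiff]
      have hxk : x k = false := by
        have hky' : y k = true := hky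
        cases hx : x k <;> simp_all [Set.mem_symmDiff]
      rcases Nat.lt_or_ge k n with hn | hn
      · refine (prefixVal_lt_of_lt (m := k + 1) hn ?_).le
        have hky' : y k = true := hky
        simp [prefixVal, hxk, hky', prefixVal_congr hlow]
      · exact (prefixVal_congr fun i hi => hlow i (hi.trans_le hn)).le
  · intro h
    by_cases hxy : ∃ n, x n ≠ y n
    · right
      classical
      have hk := Nat.find_spec hxy
      have hlow : ∀ i < Nat.find hxy, x i = y i := fun i hi => not_not.1 (Nat.find_min hxy hi)
      have hle := h (Nat.find hxy + 1)
      rw [prefixVal, prefixVal, prefixVal_congr hlow] at hle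
      have hb : x (Nat.find hxy) = false ∧ y (Nat.find hxy) = true := by
        cases hx : x (Nat.find hxy) <;> cases hy : y (Nat.find hxy) <;> simp_all
      refine ⟨Nat.find hxy, ⟨by simp [Set.mem_symmDiff, hb.1, hb.2], ?_⟩, hb.2⟩
      intro i hi
      refine Nat.find_min' hxy fun he => ?_
      simp [Set.mem_symmDiff, he] at hi
    · left
      push Not at hxy
      ext i
      simp [hxy i]

/-! ### Monotone sequences and their limits -/

/-- The sequence of characteristic functions `T` is nondecreasing in the lexicographic order. -/
def LexMono (T : ℕ → ℕ → Bool) : Prop :=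
  ∀ s n, prefixVal (T s) n ≤ prefixVal (T (s + 1)) n

/-- The sequence of characteristic functions `T` converges pointwise to `x`. -/
def Lim (T : ℕ → ℕ → Bool) (x : ℕ → Bool) : Prop :=
  ∀ n, ∀ᶠ s in atTop, T s n = x n

theorem LexMono.monotone {T : ℕ → ℕ → Bool} (h : LexMono T) (n : ℕ) :
    Monotone fun s => prefixVal (T s) n :=
  monotone_nat_of_le_succ fun s => h s n

theorem Lim.unique {T : ℕ → ℕ → Bool} {x y : ℕ → Bool} (hx : Lim T x) (hy : Lim T y) : x = y := by
  funext n
  obtain ⟨s, h1, h2⟩ := ((hx n).and (hy n)).exists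
  exact h1.symm.trans h2

theorem Lim.eventually_prefixVal_eq {T : ℕ → ℕ → Bool} {x : ℕ → Bool} (h : Lim T x) (n : ℕ) :
    ∀ᶠ s in atTop, prefixVal (T s) n = prefixVal x n := by
  have : ∀ᶠ s in atTop, ∀ i ∈ Finset.range n, T s i = x i :=
    (eventually_all_finset _).2 fun i _ => h i
  exact this.mono fun s hs => prefixVal_congr fun i hi => hs i (Finset.mem_range.2 hi)

theorem LexMono.le_lim {T : ℕ → ℕ → Bool} {x : ℕ → Bool} (hT : LexMono T) (h : Lim T x)
    (s n : ℕ) : prefixVal (T s) n ≤ prefixVal x n := by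
  obtain ⟨t, ht, hst⟩ := ((h.eventually_prefixVal_eq n).and (eventually_ge_atTop s)).exists
  exact ht ▸ hT.monotone n hst

/-- For each fixed length the prefix values form a bounded nondecreasing sequence of integers, hence
stabilize, and with them the digits. -/
theorem LexMono.exists_lim {T : ℕ → ℕ → Bool} (h : LexMono T) : ∃ x, Lim T x := by
  have key : ∀ n, ∃ b, ∀ᶠ s in atTop, T s n = b := by
    intro n
    have hb : BddAbove (Set.range fun s => prefixVal (T s) (n + 1)) :=
      ⟨2 ^ (n + 1), by rintro _ ⟨s, rfl⟩; exact (prefixVal_lt _ _).le⟩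
    have ht := tendsto_atTop_ciSup (h.monotone (n + 1)) hb
    rw [nhds_discrete, tendsto_pure] at ht
    obtain ⟨t, ht'⟩ := ht.exists
    exact ⟨T t n, ht.mono fun s hs => eq_of_prefixVal_eq (hs.trans ht'.symm) n n.lt_succ_self⟩
  choose x hx using key
  exact ⟨x, hx⟩

/-! ### Translation to Boolean characteristic functions -/

open Classical in
/-- The characteristic function of a set. -/
noncomputable def char (A : Set ℕ) : ℕ → Bool := fun i => decide (i ∈ A)

theorem char_eq_true {A : Set ℕ} {i : ℕ} : char A i = true ↔ i ∈ A := by simp [char]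

theorem char_injective : Function.Injective char := fun A B h => by
  ext i
  rw [← char_eq_true, h, char_eq_true]

theorem char_setOf (x : ℕ → Bool) : char {i | x i = true} = x := by
  funext i
  simp [char]

theorem convergesTo_iff {x : ℕ → ℕ → Bool} {A : Set ℕ} :
    ConvergesTo (fun s => {i | x s i = true}) A ↔ Lim x (char A) := by
  refine forall_congr' fun n => eventually_congr (Eventually.of_forall fun s => ?_)
  rw [Bool.eq_iff_iff, char_eq_true]
  rfl

theorem isLeftRE_iff {A : Set ℕ} :
    IsLeftRE A ↔ ∃ T : ℕ → ℕ → Bool,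
      Computable (fun p : ℕ × ℕ => T p.1 p.2) ∧ LexMono T ∧ Lim T (char A) := by
  constructor
  · rintro ⟨S, hS, hmono, hlim⟩
    obtain ⟨f, hf, hSf⟩ := ComputablePred.computable_iff.1 hS
    have hS' : S = fun s => {i | f (s, i) = true} := by
      funext s
      ext i
      exact iff_of_eq (congrFun hSf (s, i))
    subst hS'
    exact ⟨fun s i => f (s, i), hf, fun s => lexLE_iff.1 (hmono s), convergesTo_iff.1 hlim⟩
  · rintro ⟨T, hT, hmono, hlim⟩
    exact ⟨fun s => {i | T s i = true}, ComputablePred.computable_iff.2 ⟨_, hT, rfl⟩,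
      fun s => lexLE_iff.2 (hmono s), convergesTo_iff.2 hlim⟩

theorem isLeftRENumbering_iff {α : ℕ → Set ℕ} :
    IsLeftRENumbering α ↔ ∃ T : ℕ → ℕ → ℕ → Bool,
      Computable (fun p : ℕ × ℕ × ℕ => T p.1 p.2.1 p.2.2) ∧ (∀ e, LexMono (T e)) ∧
        ∀ e, Lim (T e) (char (α e)) := by
  constructor
  · rintro ⟨S, hS, hmono, hlim⟩
    obtain ⟨f, hf, hSf⟩ := ComputablePred.computable_iff.1 hS
    have hS' : S = fun e s => {i | f (e, s, i) = true} := by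
      funext e s
      ext i
      exact iff_of_eq (congrFun hSf (e, s, i))
    subst hS'
    exact ⟨fun e s i => f (e, s, i), hf, fun e s => lexLE_iff.1 (hmono e s),
      fun e => convergesTo_iff.1 (hlim e)⟩
  · rintro ⟨T, hT, hmono, hlim⟩
    exact ⟨fun e s => {i | T e s i = true}, ComputablePred.computable_iff.2 ⟨_, hT, rfl⟩,
      fun e s => lexLE_iff.2 (hmono e s), fun e => convergesTo_iff.2 (hlim e)⟩

/-! ### A numbering of all left-r.e. sets by dyadic approximations -/

theorem computable_prefixVal {σ : Type*} [Primcodable σ] {x : σ → ℕ → Bool} {n : σ → ℕ}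
    (hx : Computable₂ x) (hn : Computable n) : Computable fun a => prefixVal (x a) (n a) := by
  have hstep : Computable₂ fun (a : σ) (q : ℕ × ℕ) => 2 * q.2 + bif x a q.1 then 1 else 0 :=
    Primrec.nat_add.to_comp.comp
      (Primrec.nat_mul.to_comp.comp (Computable.const 2) (Computable.snd.comp Computable.snd))
      (Computable.cond (hx.comp Computable.fst (Computable.fst.comp Computable.snd))
        (Computable.const 1) (Computable.const 0))
  refine (Computable.nat_rec hn (Computable.const 0) hstep).of_eq fun a => ?_
  induction n a with
  | zero => rfl
  | succ m ih =>
    change 2 * _ + _ = prefixVal (x a) (m + 1)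
    rw [prefixVal, ih]
    cases x a m <;> rfl

theorem primrec_two_pow : Primrec fun n : ℕ => 2 ^ n := by
  refine (Primrec.nat_rec₁ 1 (f := fun _ r => 2 * r)
    (Primrec.nat_mul.comp (Primrec.const 2) Primrec.snd)).of_eq fun n => ?_
  induction n with
  | zero => rfl
  | succ n ih => rw [pow_succ', ← ih]

/-- The binary digits after the point of the dyadic rational `k / 2 ^ t`. -/
def dyadic (q : ℕ × ℕ) (i : ℕ) : Bool :=
  decide (q.2 * 2 ^ (i + 1) / 2 ^ q.1 % 2 = 1)

theorem primrec_dyadic : Primrec₂ dyadic := by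
  refine (Primrec.eq.decide.comp (Primrec.nat_mod.comp (Primrec.nat_div.comp
    (Primrec.nat_mul.comp (Primrec.snd.comp Primrec.fst)
      (primrec_two_pow.comp (Primrec.succ.comp Primrec.snd)))
    (primrec_two_pow.comp (Primrec.fst.comp Primrec.fst))) (Primrec.const 2))
    (Primrec.const 1)).of_eq fun p => rfl

theorem prefixVal_dyadic {q : ℕ × ℕ} (hq : q.2 < 2 ^ q.1) (n : ℕ) :
    prefixVal (dyadic q) n = q.2 * 2 ^ n / 2 ^ q.1 := by
  induction n with
  | zero => simpa [prefixVal] using (Nat.div_eq_of_lt hq).symm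
  | succ n ih =>
    have h : q.2 * 2 ^ n / 2 ^ q.1 = q.2 * 2 ^ (n + 1) / 2 ^ q.1 / 2 := by
      rw [Nat.div_div_eq_div_mul, pow_succ, ← mul_assoc, Nat.mul_div_mul_right _ _ two_pos]
    rw [prefixVal, ih, h, dyadic]
    generalize q.2 * 2 ^ (n + 1) / 2 ^ q.1 = m
    by_cases hm : m % 2 = 1 <;> simp [hm] <;> omega

theorem dyadic_prefixVal (x : ℕ → Bool) {t i : ℕ} (hi : i < t) :
    dyadic (t, prefixVal x t) i = x i := by
  refine eq_of_prefixVal_eq ?_ i hi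
  rw [prefixVal_dyadic (prefixVal_lt x t)]
  exact Nat.mul_div_cancel _ (by positivity)

open Nat.Partrec (Code)

/-- One step of the approximation by dyadic rationals computed by the code `c`: from
`k / 2 ^ t`, pass to `k' / 2 ^ (t + 1)` if `c` outputs `k'` on input `t` within `s` steps and
this number is in `[k / 2 ^ t, 1)`. -/
def approxStep (c : Code) (s : ℕ) (q : ℕ × ℕ) : ℕ × ℕ :=
  bif decide (2 * q.2 ≤ (c.evaln s q.1).getD 0) then
    -- The default fails this strict test, so without an output the state does not move, even when
    -- the default `0` passes the first test.
    bif decide ((c.evaln s q.1).getD (2 ^ (q.1 + 1)) < 2 ^ (q.1 + 1)) then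
      (q.1 + 1, (c.evaln s q.1).getD 0)
    else q
  else q

/-- The stages of the approximation by dyadic rationals computed by the code `c`. -/
def approx (c : Code) (s : ℕ) : ℕ × ℕ :=
  Nat.rec (0, 0) (approxStep c) s

theorem approxStep_of_evaln {c : Code} {s k : ℕ} {q : ℕ × ℕ} (h : k ∈ c.evaln s q.1)
    (h1 : 2 * q.2 ≤ k) (h2 : k < 2 ^ (q.1 + 1)) : approxStep c s q = (q.1 + 1, k) := by
  rw [Option.mem_def] at h
  simp [approxStep, h, h1, h2]

theorem approxStep_cases (c : Code) (s : ℕ) (q : ℕ × ℕ) :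
    approxStep c s q = q ∨ ∃ k, k ∈ c.evaln s q.1 ∧ 2 * q.2 ≤ k ∧ k < 2 ^ (q.1 + 1) ∧
      approxStep c s q = (q.1 + 1, k) := by
  rcases h : c.evaln s q.1 with _ | k
  · left
    simp [approxStep, h]
  · by_cases h1 : 2 * q.2 ≤ k
    · by_cases h2 : k < 2 ^ (q.1 + 1)
      · exact Or.inr ⟨k, rfl, h1, h2, approxStep_of_evaln h h1 h2⟩
      · left
        simp [approxStep, h, h2]
    · left
      simp [approxStep, h, h1]

theorem primrec_approx : Primrec₂ approx := by
  have hev : Primrec fun p : Code × ℕ × ℕ × ℕ => p.1.evaln p.2.1 p.2.2.1 :=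
    Nat.Partrec.Code.primrec_evaln.comp (Primrec.pair (Primrec.pair
      (Primrec.fst.comp Primrec.snd) Primrec.fst)
      (Primrec.fst.comp (Primrec.snd.comp Primrec.snd)))
  have ht : Primrec fun p : Code × ℕ × ℕ × ℕ => p.2.2.1 + 1 :=
    Primrec.succ.comp (Primrec.fst.comp (Primrec.snd.comp Primrec.snd))
  have hq : Primrec fun p : Code × ℕ × ℕ × ℕ => p.2.2 := Primrec.snd.comp Primrec.snd
  have h0 := Primrec.option_getD.comp hev (Primrec.const 0)
  have h2 := primrec_two_pow.comp ht
  have hstep : Primrec₂ fun (c : Code) (p : ℕ × ℕ × ℕ) => approxStep c p.1 p.2 :=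
    Primrec.cond
      (Primrec.nat_le.decide.comp
        (Primrec.nat_mul.comp (Primrec.const 2) (Primrec.snd.comp hq)) h0)
      (Primrec.cond (Primrec.nat_lt.decide.comp (Primrec.option_getD.comp hev h2) h2)
        (Primrec.pair ht h0) hq) hq
  exact Primrec.nat_rec (Primrec.const (0, 0)) hstep

theorem approx_lt (c : Code) (s : ℕ) : (approx c s).2 < 2 ^ (approx c s).1 := by
  induction s with
  | zero => simp [approx]
  | succ s ih =>
    change (approxStep c s (approx c s)).2 < 2 ^ (approxStep c s (approx c s)).1
    rcases approxStep_cases c s (approx c s) with h | ⟨k, -, -, hk, h⟩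
    · rwa [h]
    · rwa [h]

/-- A numbering of all left-r.e. sets: the approximation at stage `s` to the set with
index `e`. -/
def universalApprox (e s : ℕ) : ℕ → Bool :=
  dyadic (approx (Denumerable.ofNat Code e) s)

theorem computable_universalApprox :
    Computable fun p : ℕ × ℕ × ℕ => universalApprox p.1 p.2.1 p.2.2 :=
  (primrec_dyadic.comp (primrec_approx.comp ((Primrec.ofNat Code).comp Primrec.fst)
    (Primrec.fst.comp Primrec.snd)) (Primrec.snd.comp Primrec.snd)).to_comp

theorem lexMono_universalApprox (e : ℕ) : LexMono (universalApprox e) := by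
  intro s n
  unfold universalApprox
  rw [prefixVal_dyadic (approx_lt _ _), prefixVal_dyadic (approx_lt _ _)]
  generalize Denumerable.ofNat Code e = c
  change _ ≤ (approxStep c s (approx c s)).2 * 2 ^ n / 2 ^ (approxStep c s (approx c s)).1
  rcases approxStep_cases c s (approx c s) with h | ⟨k, -, hk, -, h⟩
  · rw [h]
  · rw [h]
    calc (approx c s).2 * 2 ^ n / 2 ^ (approx c s).1
        = 2 * ((approx c s).2 * 2 ^ n) / (2 * 2 ^ (approx c s).1) :=
          (Nat.mul_div_mul_left _ _ two_pos).symm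
      _ ≤ k * 2 ^ n / 2 ^ ((approx c s).1 + 1) := by
          rw [pow_succ', ← mul_assoc]
          gcongr

/-- Take a code for the diagonal prefixes of `S`. Monotonicity of `S` makes every output admissible,
so the approximation runs through the first `t` digits of `S t`, with `t` tending to infinity at the
pace of the clock. -/
theorem exists_lim_universalApprox {S : ℕ → ℕ → Bool} {x : ℕ → Bool}
    (hS : Computable fun p : ℕ × ℕ => S p.1 p.2) (hmono : LexMono S) (hx : Lim S x) :
    ∃ e, Lim (universalApprox e) x := by
  have hh : Computable fun t => prefixVal (S (t + 1)) (t + 1) :=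
    computable_prefixVal (x := fun t => S (t + 1))
      (hS.comp (Computable.pair (Computable.succ.comp Computable.fst) Computable.snd))
      Computable.succ
  obtain ⟨c, hc⟩ := Code.exists_code.1 (Partrec.nat_iff.1 hh)
  have heval : ∀ t, prefixVal (S (t + 1)) (t + 1) ∈ c.eval t := fun t => by
    rw [hc]
    exact Part.mem_some _
  have hstep : ∀ t, 2 * prefixVal (S t) t ≤ prefixVal (S (t + 1)) (t + 1) := fun t => by
    refine le_trans ?_ (hmono t (t + 1))
    rw [prefixVal]
    exact Nat.le_add_right _ _
  have hval : ∀ s, (approx c s).2 = prefixVal (S (approx c s).1) (approx c s).1 := by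
    intro s
    induction s with
    | zero => rfl
    | succ s ih =>
      change (approxStep c s (approx c s)).2 = prefixVal (S (approxStep c s (approx c s)).1)
        (approxStep c s (approx c s)).1
      rcases approxStep_cases c s (approx c s) with h | ⟨k, hk, -, -, h⟩
      · rwa [h]
      · rw [h]
        exact Part.mem_unique (Code.evaln_sound hk) (heval _)
  have hle : Monotone fun s => (approx c s).1 := monotone_nat_of_le_succ fun s => by
    change _ ≤ (approxStep c s (approx c s)).1
    rcases approxStep_cases c s (approx c s) with h | ⟨k, -, -, -, h⟩ <;> simp [h]
  have hunb : ∀ m, ∃ s, m ≤ (approx c s).1 := by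
    intro m
    induction m with
    | zero => exact ⟨0, Nat.zero_le _⟩
    | succ m ih =>
      obtain ⟨s, hs⟩ := ih
      rcases hs.lt_or_eq with hs | hs
      · exact ⟨s, hs⟩
      obtain ⟨k, hk⟩ := Code.evaln_complete.1 (heval m)
      -- At stage `max s k` the clock suffices for input `m`: either level `m` has already been
      -- passed, or the next step passes it.
      have hs' : m ≤ (approx c (max s k)).1 := hs.le.trans (hle (le_max_left _ _))
      rcases hs'.lt_or_eq with hlt | heq
      · exact ⟨_, hlt⟩
      refine ⟨max s k + 1, ?_⟩
      have hk' := Code.evaln_mono (le_max_right s k) hk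
      rw [heq] at hk'
      have := approxStep_of_evaln hk' (by rw [hval]; exact hstep _) (prefixVal_lt _ _)
      change m + 1 ≤ (approxStep c (max s k) (approx c (max s k))).1
      rw [this, ← heq]
  have htop : Tendsto (fun s => (approx c s).1) atTop atTop :=
    tendsto_atTop_atTop_of_monotone hle hunb
  refine ⟨Encodable.encode c, fun n => ?_⟩
  filter_upwards [htop.eventually (hx n), htop.eventually (eventually_gt_atTop n)] with s h1 h2
  rw [universalApprox, Denumerable.ofNat_encode, ← h1, ← dyadic_prefixVal (S _) h2, ← hval]

/-! ### Sets that equal `A` exactly at the indices in `A` -/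

/-- The set `x` if it contains `e`, and its part below `e` otherwise. -/
def truncUnless (e : ℕ) (x : ℕ → Bool) (i : ℕ) : Bool := x i && (x e || decide (i < e))

theorem truncUnless_of_lt {e i : ℕ} (x : ℕ → Bool) (h : i < e) : truncUnless e x i = x i := by
  simp [truncUnless, h]

theorem truncUnless_of_mem {e : ℕ} {x : ℕ → Bool} (h : x e = true) : truncUnless e x = x := by
  funext i
  simp [truncUnless, h]

/-- An increase below `e` settles the comparison. If nothing changes below `e`, then `e` can only
enter, which increases the truncated set at position `e`. -/
theorem truncUnless_mono {x y : ℕ → Bool} (h : ∀ n, prefixVal x n ≤ prefixVal y n) (e n : ℕ) :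
    prefixVal (truncUnless e x) n ≤ prefixVal (truncUnless e y) n := by
  have hle : ∀ (z : ℕ → Bool), ∀ m ≤ e, prefixVal (truncUnless e z) m = prefixVal z m :=
    fun z m hm => prefixVal_congr fun i hi => truncUnless_of_lt z (hi.trans_le hm)
  rcases le_or_gt n e with hn | hn
  · rw [hle x n hn, hle y n hn]
    exact h n
  rcases (h e).lt_or_eq with hlt | heq
  · refine (prefixVal_lt_of_lt hn.le ?_).le
    rwa [hle x e le_rfl, hle y e le_rfl]
  have hstep := h (e + 1)
  rw [prefixVal, prefixVal, heq] at hstep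
  cases hx : x e <;> cases hy : y e
  · refine (prefixVal_congr fun i _ => ?_).le
    by_cases hi : i < e
    · rw [truncUnless_of_lt x hi, truncUnless_of_lt y hi, eq_of_prefixVal_eq heq i hi]
    · simp [truncUnless, hx, hy, hi]
  · refine (prefixVal_lt_of_lt (m := e + 1) hn ?_).le
    rw [prefixVal, prefixVal, hle x e le_rfl, hle y e le_rfl, heq]
    simp [truncUnless, hx, hy]
  · simp [hx, hy] at hstep
  · rw [truncUnless_of_mem hx, truncUnless_of_mem hy]
    exact h n

theorem truncUnless_eq_iff {x : ℕ → Bool} (hx : ∀ m, ∃ i ≥ m, x i = true) (e : ℕ) :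
    truncUnless e x = x ↔ x e = true := by
  refine ⟨fun h => ?_, truncUnless_of_mem⟩
  obtain ⟨i, hi, hxi⟩ := hx e
  have := congrFun h i
  simpa [truncUnless, hxi, not_lt.2 hi] using this

theorem computable_of_eventually_false {x : ℕ → Bool} {m : ℕ} (h : ∀ i ≥ m, x i = false) :
    Computable x := by
  refine ((Primrec.list_getD false).comp (Primrec.const ((List.range m).map x))
    Primrec.id).to_comp.of_eq fun i => ?_
  rcases Nat.lt_or_ge i m with hi | hi
  · simp [List.getD, hi]
  · simp [List.getD, hi, h i hi]

theorem exists_selfIndexed {S : ℕ → ℕ → Bool} {a : ℕ → Bool}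
    (hS : Computable fun p : ℕ × ℕ => S p.1 p.2) (hmono : LexMono S) (ha : Lim S a)
    (hne : a ≠ fun _ => false) :
    ∃ (G : ℕ → ℕ → ℕ → Bool) (g : ℕ → ℕ → Bool),
      Computable (fun p : ℕ × ℕ × ℕ => G p.1 p.2.1 p.2.2) ∧ (∀ e, LexMono (G e)) ∧
        (∀ e, Lim (G e) (g e)) ∧ ∀ e, g e = a ↔ a e = true := by
  -- Truncation at `e ∉ a` changes an infinite set but may fix a finite one; a finite `a` is
  -- recursive, so there the choice between `a` and `∅` is made outright.
  by_cases hinf : ∀ m, ∃ i ≥ m, a i = true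
  · refine ⟨fun e s => truncUnless e (S s), fun e => truncUnless e a, ?_,
      fun e s => truncUnless_mono (hmono s) e, fun e i => ?_, truncUnless_eq_iff hinf⟩
    · have h1 : Computable fun p : ℕ × ℕ × ℕ => S p.2.1 p.2.2 := hS.comp Computable.snd
      have h2 : Computable fun p : ℕ × ℕ × ℕ => S p.2.1 p.1 :=
        hS.comp (Computable.pair (Computable.fst.comp Computable.snd) Computable.fst)
      exact Primrec.and.to_comp.comp h1 (Primrec.or.to_comp.comp h2
        (Primrec.nat_lt.decide.comp (Primrec.snd.comp Primrec.snd) Primrec.fst).to_comp)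
    · filter_upwards [ha i, ha e] with s h1 h2
      simp [truncUnless, h1, h2]
  · push Not at hinf
    obtain ⟨m, hm⟩ := hinf
    have hcomp : Computable a := computable_of_eventually_false (m := m) fun i hi => by
      simpa using hm i hi
    refine ⟨fun e _ i => a e && a i, fun e i => a e && a i, ?_, fun _ _ _ => le_rfl,
      fun _ _ => Eventually.of_forall fun _ => rfl, fun e => ?_⟩
    · exact Primrec.and.to_comp.comp (hcomp.comp Computable.fst)
        (hcomp.comp (Computable.snd.comp Computable.snd))
    · cases he : a e
      · simpa [he] using hne.symm
      · simp [he]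

/-! ### Listing the left-r.e. sets other than `A` -/

/-- A modification of `u` that differs from `a`, as long as `a` is neither empty nor full. If `b`
is true it is `u` when the first `n` digits certify `a < k ≤ u`, and if `b` is false when they
certify `u ≤ k < a`. -/
def avoid (q : Bool × ℕ × ℕ) (a u : ℕ → Bool) (i : ℕ) : Bool :=
  bif q.1 then
    bif decide (q.2.2 ≤ prefixVal a q.2.1) then true
    else bif decide (q.2.2 ≤ prefixVal u q.2.1) then u i else false
  else
    bif decide (prefixVal a q.2.1 ≤ q.2.2) then false
    else bif decide (prefixVal u q.2.1 ≤ q.2.2) then u i else true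

theorem avoid_true (n k : ℕ) (a u : ℕ → Bool) :
    avoid (true, n, k) a u = if k ≤ prefixVal a n then fun _ => true else
      if k ≤ prefixVal u n then u else fun _ => false := by
  funext i
  by_cases h1 : k ≤ prefixVal a n <;> by_cases h2 : k ≤ prefixVal u n <;> simp [avoid, h1, h2]

theorem avoid_false (n k : ℕ) (a u : ℕ → Bool) :
    avoid (false, n, k) a u = if prefixVal a n ≤ k then fun _ => false else
      if prefixVal u n ≤ k then u else fun _ => true := by
  funext i
  by_cases h1 : prefixVal a n ≤ k <;> by_cases h2 : prefixVal u n ≤ k <;> simp [avoid, h1, h2]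

/-- As the prefixes of `a` and `u` grow, the active case can only move forward along `∅`, `u`, `ℕ`.
-/
theorem avoid_mono (q : Bool × ℕ × ℕ) {a a' u u' : ℕ → Bool}
    (ha : ∀ n, prefixVal a n ≤ prefixVal a' n) (hu : ∀ n, prefixVal u n ≤ prefixVal u' n)
    (m : ℕ) : prefixVal (avoid q a u) m ≤ prefixVal (avoid q a' u') m := by
  obtain ⟨b, n, k⟩ := q
  have h1 := ha n
  have h2 := hu n
  have h0 := prefixVal_false m
  have hu1 := prefixVal_le_true u m
  have hu2 := prefixVal_le_true u' m
  have hu3 := hu m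
  cases b
  · rw [avoid_false, avoid_false]
    split_ifs <;> omega
  · rw [avoid_true, avoid_true]
    split_ifs <;> omega

theorem avoid_ne {a : ℕ → Bool} (h0 : a ≠ fun _ => false) (h1 : a ≠ fun _ => true)
    (q : Bool × ℕ × ℕ) (u : ℕ → Bool) : avoid q a u ≠ a := by
  obtain ⟨b, n, k⟩ := q
  cases b
  · rw [avoid_false]
    split_ifs with h h'
    · exact h0.symm
    · rintro rfl
      exact h h'
    · exact h1.symm
  · rw [avoid_true]
    split_ifs with h h'
    · exact h1.symm
    · rintro rfl
      exact h h'
    · exact h0.symm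

theorem exists_avoid_eq {a u : ℕ → Bool} (h : u ≠ a) : ∃ q, avoid q a u = u := by
  have : ∃ n, prefixVal u n ≠ prefixVal a n := by
    by_contra! hn
    exact h (funext fun i => eq_of_prefixVal_eq (hn (i + 1)) i i.lt_succ_self)
  obtain ⟨n, hn⟩ := this
  rcases hn.lt_or_gt with hn | hn
  · exact ⟨(false, n, prefixVal u n), by rw [avoid_false, if_neg (not_le.2 hn), if_pos le_rfl]⟩
  · exact ⟨(true, n, prefixVal u n), by rw [avoid_true, if_neg (not_le.2 hn), if_pos le_rfl]⟩

theorem Lim.avoid {S U : ℕ → ℕ → Bool} {a u : ℕ → Bool} (hS : Lim S a) (hU : Lim U u)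
    (q : Bool × ℕ × ℕ) : Lim (fun s => avoid q (S s) (U s)) (LeftRE.avoid q a u) := by
  intro i
  filter_upwards [hS.eventually_prefixVal_eq q.2.1, hU.eventually_prefixVal_eq q.2.1, hU i]
    with s h1 h2 h3
  simp [LeftRE.avoid, h1, h2, h3]

theorem computable_avoid {σ : Type*} [Primcodable σ] {q : σ → Bool × ℕ × ℕ} {a u : σ → ℕ → Bool}
    {i : σ → ℕ} (hq : Computable q) (ha : Computable₂ a) (hu : Computable₂ u)
    (hi : Computable i) : Computable fun p => avoid (q p) (a p) (u p) (i p) := by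
  have hn : Computable fun p => (q p).2.1 := Computable.fst.comp (Computable.snd.comp hq)
  have hk : Computable fun p => (q p).2.2 := Computable.snd.comp (Computable.snd.comp hq)
  have hle : Computable₂ fun m n : ℕ => decide (m ≤ n) := Primrec.nat_le.decide.to_comp
  have hpa := computable_prefixVal ha hn
  have hpu := computable_prefixVal hu hn
  have hui : Computable fun p => u p (i p) := hu.comp Computable.id hi
  exact Computable.cond (Computable.fst.comp hq)
    (Computable.cond (hle.comp hk hpa) (Computable.const true)
      (Computable.cond (hle.comp hk hpu) hui (Computable.const false)))
    (Computable.cond (hle.comp hpa hk) (Computable.const false)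
      (Computable.cond (hle.comp hpu hk) hui (Computable.const true)))

/-! ### R.e. sets, increasing enumerations and their inverses -/

theorem exists_computable_of_rePred {p : ℕ → Prop} (hp : REPred p) :
    ∃ R : ℕ → ℕ → Bool, Computable₂ R ∧ ∀ n, p n ↔ ∃ s, R n s = true := by
  obtain ⟨c, hc⟩ := Code.exists_code.1 (Partrec.nat_iff.1 (hp.map (Computable.const 0).to₂))
  refine ⟨fun n s => (c.evaln s n).isSome, ?_, fun n => ?_⟩
  · exact (Primrec.option_isSome.comp (Nat.Partrec.Code.primrec_evaln.comp
      (Primrec.pair (Primrec.pair Primrec.snd (Primrec.const c)) Primrec.fst))).to_comp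
  · have h : (c.eval n).Dom ↔ p n := by
      rw [hc]
      simp [Part.assert]
    rw [← h, Part.dom_iff_mem]
    simp only [Code.evaln_complete, Option.isSome_iff_exists]
    exact exists_comm

theorem rePred_exists {R : ℕ → ℕ → Bool} (hR : Computable₂ R) :
    REPred fun n => ∃ s, R n s = true := by
  have h : Partrec fun n => Nat.rfind fun s => Part.some (R n s) :=
    Partrec.rfind hR.partrec₂
  refine h.dom_re.of_eq fun n => Nat.rfind_dom.trans ?_
  simp

theorem exists_strictMono_of_rePred {B : Set ℕ} (hinf : B.Infinite)
    (hB : REPred fun n => n ∈ B) : ∃ f : ℕ → ℕ, Computable f ∧ StrictMono f ∧ ∀ k, f k ∈ B := by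
  obtain ⟨R, hR, hBR⟩ := exists_computable_of_rePred hB
  have hex : ∀ x : ℕ, ∃ p : ℕ, x < p.unpair.1 ∧ R p.unpair.1 p.unpair.2 = true := by
    intro x
    obtain ⟨n, hn, hxn⟩ := hinf.exists_gt x
    obtain ⟨s, hs⟩ := (hBR n).1 hn
    exact ⟨Nat.pair n s, by simpa using ⟨hxn, hs⟩⟩
  have hP : ComputablePred fun q : ℕ × ℕ =>
      q.1 < q.2.unpair.1 ∧ R q.2.unpair.1 q.2.unpair.2 = true := by
    have hun : Computable fun q : ℕ × ℕ => q.2.unpair :=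
      (Primrec.unpair.comp Primrec.snd).to_comp
    refine Computable.computablePred ((Primrec.and.to_comp.comp
      (Primrec.nat_lt.decide.to_comp.comp Computable.fst (Computable.fst.comp hun))
      (hR.comp (Computable.fst.comp hun) (Computable.snd.comp hun))).of_eq fun q => ?_)
    simp
  have hfind := Computable.find hP hex
  let next : ℕ → ℕ := fun x => (Nat.find (hex x)).unpair.1
  have hnext : Computable next :=
    Computable.fst.comp (Primrec.unpair.to_comp.comp hfind)
  have hlt : ∀ x, x < next x := fun x => (Nat.find_spec (hex x)).1
  have hmem : ∀ x, next x ∈ B := fun x => (hBR _).2 ⟨_, (Nat.find_spec (hex x)).2⟩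
  refine ⟨fun k => Nat.rec (next 0) (fun _ r => next r) k, ?_,
    strictMono_nat_of_lt_succ fun k => hlt _, fun k => ?_⟩
  · exact Computable.nat_rec Computable.id (Computable.const _)
      (hnext.comp (Computable.snd.comp Computable.snd)).to₂
  · cases k <;> exact hmem _

theorem computable_comp₃ {σ : Type*} [Primcodable σ] {T : ℕ → ℕ → ℕ → Bool} {a b c : σ → ℕ}
    (hT : Computable fun p : ℕ × ℕ × ℕ => T p.1 p.2.1 p.2.2) (ha : Computable a)
    (hb : Computable b) (hc : Computable c) : Computable fun q => T (a q) (b q) (c q) :=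
  hT.comp (g := fun q => (a q, b q, c q)) (Computable.pair ha (Computable.pair hb hc))

theorem exists_computable_inverse {f : ℕ → ℕ} (hf : Computable f) (hmono : StrictMono f) :
    ∃ g : ℕ → Option ℕ, Computable g ∧ ∀ e k, g e = some k ↔ f k = e := by
  let h : ℕ → ℕ → Option ℕ := fun e m =>
    Nat.rec none (fun k r => bif decide (f k = e) then some k else r) m
  have hh : ∀ e m k, h e m = some k ↔ k < m ∧ f k = e := by
    intro e m k
    induction m with
    | zero => simp [h]
    | succ m ih =>
      change (bif decide (f m = e) then some m else h e m) = some k ↔ _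
      by_cases hm : f m = e
      · simp only [hm, decide_true, cond_true, Option.some.injEq]
        refine ⟨?_, fun hk => hmono.injective (hm.trans hk.2.symm)⟩
        rintro rfl
        exact ⟨Nat.lt_succ_self _, hm⟩
      · simp only [hm, decide_false, cond_false, ih]
        refine and_congr_left fun hk => ⟨fun hkm => by omega, fun hkm => ?_⟩
        rcases Nat.lt_succ_iff_lt_or_eq.1 hkm with hkm | rfl
        · exact hkm
        · exact absurd hk hm
  -- Strict monotonicity gives `k ≤ f k`, so searching `k ≤ e` is enough.
  refine ⟨fun e => h e (e + 1), ?_, fun e k => ?_⟩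
  · have hstep : Computable₂ fun (e : ℕ) (q : ℕ × Option ℕ) =>
        bif decide (f q.1 = e) then some q.1 else q.2 := Computable.cond (Primrec.eq.decide.to_comp.comp
      (hf.comp (Computable.fst.comp Computable.snd)) Computable.fst)
      (Computable.option_some.comp (Computable.fst.comp Computable.snd))
      (Computable.snd.comp Computable.snd)
    exact Computable.nat_rec Computable.succ (Computable.const none) hstep
  · refine (hh e (e + 1) k).trans ?_
    refine and_iff_right_of_imp ?_
    rintro rfl
    exact Nat.lt_succ_of_le (hmono.id_le k)

/-! ### Sufficiency: the self-indexing numbering -/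

theorem canBeMadeIntoItself_singleton {A : Set ℕ} (hA : IsLeftRE A) (hne : A ≠ ∅) {B : Set ℕ}
    (hinf : B.Infinite) (hB : REPred fun n => n ∈ B) (hAB : A ∩ B = ∅) :
    CanBeMadeIntoItself {A} := by
  obtain ⟨S, hS, hSmono, hSlim⟩ := isLeftRE_iff.1 hA
  have h0 : char A ≠ fun _ => false := by
    intro h
    refine hne (Set.eq_empty_of_forall_notMem fun i hi => ?_)
    simpa [h] using char_eq_true.2 hi
  have h1 : char A ≠ fun _ => true := by
    intro h
    obtain ⟨i, hi⟩ := hinf.nonempty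
    exact Set.eq_empty_iff_forall_notMem.1 hAB i ⟨char_eq_true.1 (congrFun h i), hi⟩
  obtain ⟨G, g, hG, hGmono, hGlim, hg⟩ := exists_selfIndexed hS hSmono hSlim h0
  obtain ⟨f, hf, hfmono, hfB⟩ := exists_strictMono_of_rePred hinf hB
  obtain ⟨ι, hι, hιf⟩ := exists_computable_inverse hf hfmono
  choose u hu using fun e => (lexMono_universalApprox e).exists_lim
  -- The default for undecodable `k` is arbitrary: `avoid` differs from `A` for every parameter.
  let par : ℕ → ℕ × Bool × ℕ × ℕ := fun k => (Encodable.decode k).getD (0, false, 0, 0)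
  let T : ℕ → ℕ → ℕ → Bool := fun e s i => Option.casesOn (ι e) (G e s i) fun k =>
    avoid (par k).2 (S s) (universalApprox (par k).1 s) i
  let β : ℕ → ℕ → Bool := fun e => Option.casesOn (ι e) (g e) fun k =>
    avoid (par k).2 (char A) (u (par k).1)
  have hT : Computable fun p : ℕ × ℕ × ℕ => T p.1 p.2.1 p.2.2 := by
    refine Computable.option_casesOn (hι.comp Computable.fst) hG ?_
    have hpar : Computable fun p : (ℕ × ℕ × ℕ) × ℕ => par p.2 :=
      Computable.option_getD (Computable.decode.comp Computable.snd) (Computable.const _)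
    have hs : Computable fun p : (ℕ × ℕ × ℕ) × ℕ => p.1.2.1 :=
      Computable.fst.comp (Computable.snd.comp Computable.fst)
    have ha : Computable fun q : ((ℕ × ℕ × ℕ) × ℕ) × ℕ => S q.1.1.2.1 q.2 :=
      hS.comp (g := fun q : ((ℕ × ℕ × ℕ) × ℕ) × ℕ => (q.1.1.2.1, q.2))
        (Computable.pair (hs.comp Computable.fst) Computable.snd)
    have hua : Computable fun q : ((ℕ × ℕ × ℕ) × ℕ) × ℕ =>
        universalApprox (par q.1.2).1 q.1.1.2.1 q.2 :=
      computable_comp₃ computable_universalApprox ((Computable.fst.comp hpar).comp Computable.fst)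
        (hs.comp Computable.fst) Computable.snd
    exact computable_avoid (a := fun p : (ℕ × ℕ × ℕ) × ℕ => S p.1.2.1)
      (u := fun p => universalApprox (par p.2).1 p.1.2.1) (Computable.snd.comp hpar) ha hua
      (Computable.snd.comp (Computable.snd.comp Computable.fst))
  have hTmono : ∀ e, LexMono (T e) := by
    intro e s n
    rcases h : ι e with _ | k
    · simpa only [T, h] using hGmono e s n
    · simpa only [T, h] using avoid_mono _ (hSmono s) (lexMono_universalApprox _ s) n
  have hTlim : ∀ e, Lim (T e) (β e) := by
    intro e n
    rcases h : ι e with _ | k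
    · simpa only [T, β, h] using hGlim e n
    · simpa only [T, β, h] using hSlim.avoid (hu (par k).1) (par k).2 n
  have hβ : ∀ e, β e = char A ↔ e ∈ A := by
    intro e
    rcases h : ι e with _ | k
    · simp only [β, h, hg, char_eq_true]
    · have he : e ∉ A := fun he =>
        Set.eq_empty_iff_forall_notMem.1 hAB e ⟨he, (hιf e k).1 h ▸ hfB k⟩
      simp only [β, h, he, iff_false]
      exact avoid_ne h0 h1 _ _
  refine ⟨fun e => {i | β e i = true}, ⟨isLeftRENumbering_iff.2
    ⟨T, hT, hTmono, fun e => by rw [char_setOf]; exact hTlim e⟩, fun X hX => ?_⟩, ?_⟩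
  · suffices h : ∃ e, β e = char X by
      obtain ⟨e, he⟩ := h
      exact ⟨e, char_injective (by rw [char_setOf, he])⟩
    by_cases hXA : X = A
    · obtain ⟨e, he⟩ := Set.nonempty_iff_ne_empty.2 hne
      exact ⟨e, hXA ▸ (hβ e).2 he⟩
    · obtain ⟨V, hV, hVmono, hVlim⟩ := isLeftRE_iff.1 hX
      obtain ⟨e, he⟩ := exists_lim_universalApprox hV hVmono hVlim
      obtain ⟨q, hq⟩ := exists_avoid_eq fun h => hXA (char_injective h)
      refine ⟨f (Encodable.encode (e, q)), ?_⟩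
      simp only [β, (hιf _ _).2 rfl, par, Encodable.encodek, Option.getD_some]
      rw [(hu e).unique he, hq]
  · refine Set.mem_singleton_iff.2 (Set.ext fun e => ?_)
    rw [← hβ e]
    change {i | β e i = true} = A ↔ _
    rw [← char_injective.eq_iff, char_setOf]

/-! ### Necessity: an infinite r.e. set of non-indices -/

theorem isLeftRE_of_finite {X : Set ℕ} (hX : X.Finite) : IsLeftRE X := by
  obtain ⟨m, hm⟩ := hX.bddAbove
  have hcomp : Computable (char X) := computable_of_eventually_false (m := m + 1) fun i hi => by
    rw [← Bool.not_eq_true, char_eq_true]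
    exact fun h => absurd (hm h) (not_le.2 hi)
  exact isLeftRE_iff.2 ⟨fun _ => char X, hcomp.comp Computable.snd, fun _ _ => le_rfl,
    fun _ => Eventually.of_forall fun _ => rfl⟩

theorem exists_infinite_re_disjoint_indexSet {β : ℕ → Set ℕ} (hβ : IsUniversalLeftRENumbering β)
    {A : Set ℕ} {m : ℕ} (hm : m ∉ A) :
    ∃ B : Set ℕ, B.Infinite ∧ REPred (fun n => n ∈ B) ∧ indexSet β {A} ∩ B = ∅ := by
  obtain ⟨T, hT, hTmono, hTlim⟩ := isLeftRENumbering_iff.1 hβ.1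
  let k := prefixVal (char A) (m + 1)
  let B : Set ℕ := {e | ∃ s, k < prefixVal (T e s) (m + 1)}
  have hB : ∀ e, e ∈ B ↔ k < prefixVal (char (β e)) (m + 1) := by
    intro e
    constructor
    · rintro ⟨s, hs⟩
      exact hs.trans_le ((hTmono e).le_lim (hTlim e) s _)
    · intro h
      obtain ⟨s, hs⟩ := ((hTlim e).eventually_prefixVal_eq (m + 1)).exists
      exact ⟨s, hs ▸ h⟩
  refine ⟨B, ?_, ?_, ?_⟩
  · let F : ℕ → Set ℕ := fun j => {i | i < m ∧ i ∈ A} ∪ {m, m + 1 + j}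
    have hF : ∀ j, ∃ e, β e = F j := fun j => hβ.2 _ (isLeftRE_of_finite
      (((Set.finite_lt_nat m).subset fun i hi => hi.1).union (Set.toFinite _)))
    choose idx hidx using hF
    have hinj : Function.Injective idx := by
      intro i j hij
      have hFij : F i = F j := by rw [← hidx i, ← hidx j, hij]
      have : m + 1 + i ∈ F j := hFij ▸ Or.inr (Or.inr rfl)
      rcases this with h | h | h
      · exact absurd h.1 (by omega)
      · omega
      · have : m + 1 + i = m + 1 + j := h
        omega
    refine (Set.infinite_range_of_injective hinj).mono ?_
    rintro _ ⟨j, rfl⟩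
    rw [hB, hidx]
    have hlow : prefixVal (char (F j)) m = prefixVal (char A) m := prefixVal_congr fun i hi => by
      rw [Bool.eq_iff_iff, char_eq_true, char_eq_true]
      constructor
      · rintro (h | h | h)
        · exact h.2
        · omega
        · have : i = m + 1 + j := h
          omega
      · exact fun h => Or.inl ⟨hi, h⟩
    have hFm : char (F j) m = true := char_eq_true.2 (Or.inr (Or.inl rfl))
    have hAm : char A m = false := by rwa [← Bool.not_eq_true, char_eq_true]
    simp [k, prefixVal, hlow, hFm, hAm]
  · have hdec : Computable₂ fun e s : ℕ => decide (k < prefixVal (T e s) (m + 1)) := by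
      have hlt : Computable₂ fun i j : ℕ => decide (i < j) := Primrec.nat_lt.decide.to_comp
      have hTe : Computable fun q : (ℕ × ℕ) × ℕ => T q.1.1 q.1.2 q.2 :=
        computable_comp₃ hT (Computable.fst.comp Computable.fst)
          (Computable.snd.comp Computable.fst) Computable.snd
      exact hlt.comp (Computable.const k)
        (computable_prefixVal (x := fun p : ℕ × ℕ => T p.1 p.2) hTe (Computable.const (m + 1)))
    exact (rePred_exists hdec).of_eq fun e => by simp [B]
  · refine Set.eq_empty_of_forall_notMem fun e ⟨heA, heB⟩ => ?_
    have : β e = A := heA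
    exact lt_irrefl k (by simpa [k, this] using (hB e).1 heB)

theorem not_canBeMadeIntoItself_univ : ¬ CanBeMadeIntoItself {Set.univ} := by
  rintro ⟨β, hβ, h⟩
  obtain ⟨e, he⟩ := hβ.2 ∅ (isLeftRE_of_finite Set.finite_empty)
  have hmem : e ∈ indexSet β {Set.univ} := (Set.mem_singleton_iff.1 h).symm ▸ Set.mem_univ e
  have : β e = Set.univ := hmem
  exact Set.empty_ne_univ (he.symm.trans this)

end LeftRE

theorem mainTheorem3 (A : Set ℕ) (hA : LeftRE.IsLeftRE A) :
    LeftRE.CanBeMadeIntoItself {A} ↔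
      A ≠ ∅ ∧ ∃ B : Set ℕ, B.Infinite ∧ REPred (fun n => n ∈ B) ∧ A ∩ B = ∅ := by
  constructor
  · intro h
    have huniv : A ≠ Set.univ := by
      rintro rfl
      exact LeftRE.not_canBeMadeIntoItself_univ h
    obtain ⟨β, hβ, hβA⟩ := h
    have hβA' : LeftRE.indexSet β {A} = A := hβA
    obtain ⟨e, he⟩ := hβ.2 A hA
    obtain ⟨m, hm⟩ := (Set.ne_univ_iff_exists_notMem A).1 huniv
    refine ⟨Set.nonempty_iff_ne_empty.1 ⟨e, hβA' ▸ he⟩, ?_⟩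
    have := LeftRE.exists_infinite_re_disjoint_indexSet hβ hm
    rwa [hβA'] at this
  · rintro ⟨hne, B, hinf, hB, hAB⟩
    exact LeftRE.canBeMadeIntoItself_singleton hA hne hinf hB hAB
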